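/- Let $(X,d)$ be a metric space, $f:X\to X$ a map and $x_0\in X$. A \emph{$\delta$-pseudoorbit} of $f$ of length $n$ starting at $x_0$ is a sequence $(x_0,x_1,\dots,x_n)$ in $X$ with $d(f(x_i),x_{i+1})\le\delta$ for $i=0,\dots,n-1$. The distance between two such sequences $(x_i)$ and $(y_i)$ is $\max_{0\le i\le n} d(x_i,y_i)$, and a set of them is \emph{$R$-separated} if any two distinct elements of it are at distance at least $R$. Let $s(f,n,R,\delta,x_0)$ be the supremum of the cardinalities of $R$-separated sets of $\delta$-pseudoorbits of $f$ of length $n$ starting at $x_0$. The \emph{coarse entropy} of $f$ is \[ h_\infty(f)=\lim_{\delta\to\infty}\lim_{R\to\infty}\limsup_{n\to\infty}\frac1n\log s(f,n,R,\delta,x_0)\in[0,\infty]; \] the limits exist by monotonicity, and the value does not depend on the choice of $x_0$. \textbf{Theorem.} Let $q\ge 0$ and let $f:\mathbb R^q\to\mathbb R^q$ be a linear map, where $\mathbb R^q$ carries the Euclidean metric. Then, for every choice of $x_0\in\mathbb R^q$, $h_\infty(f)=\log\Lambda$, where $\Lambda$ is the absolute value of the product of all complex eigenvalues of $f$, counted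 with algebraic multiplicity, that have absolute value larger than $1$ (with $\Lambda=1$ if there are none). -/

import Mathlib

open Filter Topology

noncomputable section

namespace CoarseEntropy

/-- The set of `δ`-pseudoorbits `(x 0, x 1, …, x n)` of `f`, of length `n`, starting at `x₀`. -/
def pseudoOrbits {X : Type*} [MetricSpace X] (f : X → X) (n : ℕ) (δ : ℝ) (x₀ : X) :
    Set (Fin (n + 1) → X) :=
  {x | x 0 = x₀ ∧ ∀ i : Fin n, dist (f (x i.castSucc)) (x i.succ) ≤ δ}

/-- A set is `R`-separated if any two distinct elements of it are at distance at least `R`. -/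
def IsRSeparated {Y : Type*} [MetricSpace Y] (R : ℝ) (E : Set Y) : Prop :=
  ∀ x ∈ E, ∀ y ∈ E, x ≠ y → R ≤ dist x y

/-- `s(f, n, R, δ, x₀)`: the supremum of the cardinalities of `R`-separated sets of
`δ`-pseudoorbits of length `n` starting at `x₀`. The distance on `Fin (n + 1) → X` is the
maximum of the distances of the coordinates. -/
def sepNum {X : Type*} [MetricSpace X] (f : X → X) (n : ℕ) (R δ : ℝ) (x₀ : X) : ℕ∞ :=
  ⨆ (E : Set (Fin (n + 1) → X)) (_ : E ⊆ pseudoOrbits f n δ x₀) (_ : IsRSeparated R E), E.encard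

/-- `limsup_{n → ∞} (1 / n) log s(f, n, R, δ, x₀)`, as an extended real number. -/
def sepGrowth {X : Type*} [MetricSpace X] (f : X → X) (R δ : ℝ) (x₀ : X) : EReal :=
  limsup (fun n : ℕ => ENNReal.log ((sepNum f n R δ x₀ : ℕ∞) : ENNReal) / (n : EReal)) atTop

/-- The coarse entropy of `f`, computed from the base point `x₀`:
`lim_{δ → ∞} lim_{R → ∞} limsup_{n → ∞} (1 / n) log s(f, n, R, δ, x₀)`.
Both limits exist in the extended reals, see `tendsto_sepGrowth` and `tendsto_coarseEntropy`. -/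
def coarseEntropy {X : Type*} [MetricSpace X] (f : X → X) (x₀ : X) : EReal :=
  limUnder atTop fun δ : ℝ => limUnder atTop fun R : ℝ => sepGrowth f R δ x₀

theorem sepGrowth_le {X : Type*} [MetricSpace X] (f : X → X) {R R' δ δ' : ℝ} (x₀ : X)
    (hR : R' ≤ R) (hδ : δ ≤ δ') : sepGrowth f R δ x₀ ≤ sepGrowth f R' δ' x₀ := by
  refine limsup_le_limsup (Eventually.of_forall fun n => ?_)
  refine EReal.div_le_div_right_of_nonneg (Nat.cast_nonneg' n) (ENNReal.log_monotone ?_)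
  refine ENat.toENNReal_le.2 (iSup_le fun E => iSup_le fun hE => iSup_le fun hs => ?_)
  exact le_iSup_of_le E (le_iSup_of_le (fun x hx => ⟨(hE hx).1, fun i => ((hE hx).2 i).trans hδ⟩)
    (le_iSup_of_le (fun x hx y hy h => hR.trans (hs x hx y hy h)) le_rfl))

theorem lim_sepGrowth {X : Type*} [MetricSpace X] (f : X → X) (δ : ℝ) (x₀ : X) :
    limUnder atTop (fun R : ℝ => sepGrowth f R δ x₀) = ⨅ R : ℝ, sepGrowth f R δ x₀ :=
  (tendsto_atTop_iInf fun _ _ h => sepGrowth_le f x₀ h le_rfl).limUnder_eq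

/-- The inner limit in the definition of the coarse entropy exists. -/
theorem tendsto_sepGrowth {X : Type*} [MetricSpace X] (f : X → X) (δ : ℝ) (x₀ : X) :
    Tendsto (fun R : ℝ => sepGrowth f R δ x₀) atTop
      (𝓝 (limUnder atTop fun R : ℝ => sepGrowth f R δ x₀)) := by
  rw [lim_sepGrowth]
  exact tendsto_atTop_iInf fun _ _ h => sepGrowth_le f x₀ h le_rfl

theorem monotone_lim_sepGrowth {X : Type*} [MetricSpace X] (f : X → X) (x₀ : X) :
    Monotone fun δ : ℝ => limUnder atTop fun R : ℝ => sepGrowth f R δ x₀ := by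
  intro δ δ' h
  simp only [lim_sepGrowth]
  exact iInf_mono fun R => sepGrowth_le f x₀ le_rfl h

theorem coarseEntropy_eq {X : Type*} [MetricSpace X] (f : X → X) (x₀ : X) :
    coarseEntropy f x₀ = ⨆ δ : ℝ, ⨅ R : ℝ, sepGrowth f R δ x₀ := by
  simp only [← lim_sepGrowth]
  exact (tendsto_atTop_iSup (monotone_lim_sepGrowth f x₀)).limUnder_eq

/-- The outer limit in the definition of the coarse entropy exists. -/
theorem tendsto_coarseEntropy {X : Type*} [MetricSpace X] (f : X → X) (x₀ : X) :
    Tendsto (fun δ : ℝ => limUnder atTop fun R : ℝ => sepGrowth f R δ x₀) atTop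
      (𝓝 (coarseEntropy f x₀)) := by
  rw [coarseEntropy_eq]
  simp only [← lim_sepGrowth]
  exact tendsto_atTop_iSup (monotone_lim_sepGrowth f x₀)

/-- The absolute value of the product of all complex eigenvalues of `f`, counted with algebraic
multiplicity, whose absolute value is larger than `1` (the empty product is `1`). -/
def expandingProduct {q : ℕ} (f : EuclideanSpace ℝ (Fin q) →ₗ[ℝ] EuclideanSpace ℝ (Fin q)) : ℝ :=
  ‖((f.charpoly.map (algebraMap ℝ ℂ)).roots.filter fun z : ℂ => 1 < ‖z‖).prod‖

end CoarseEntropy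

end

/-! ### Power growth and real factorization by modulus of roots -/

section LinearAlgebra

open Polynomial

attribute [local instance] Matrix.linftyOpNormedAddCommGroup Matrix.linftyOpNormedRing
  Matrix.linftyOpNormedAlgebra Matrix.linftyOpNormedSpace

/-! Entropy is volume growth along the expanding part. Split the space into invariant `U ⊕ W`, with
eigenvalues of modulus `> 1` on `U` and `≤ 1` on `W`; then `|det f|_U| = Λ`.

Lower bound (`le_sepNum_of_invariant`): let the first step jump by any small vector of `U` and
follow `f` afterwards. The endpoints fill a set of `U`-volume a constant times `Λ ^ k`, so covering
it by `R`-balls takes at least a constant times `Λ ^ k` of them.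

Upper bound: let `g` be `f` on `U` and the identity on `W` (`LinearMap.exists_expanding_part`). As
`g⁻¹` and `g⁻¹ f` have spectral radius at most `1`, the image of the unit ball under `f ^ m` lies in
`g ^ m` of a ball of subexponential radius; comparing volumes, about `Λ ^ m` balls of radius `1/2`
cover it (`LinearMap.exists_finset_cover_pow`). By linearity this cover works at every scale `r`,
and for large `r` the drift of a pseudoorbit over `m` steps fits into the spare `r / 2`. So each
block of `m` steps costs one choice from the cover (`sepNum_le_pow`). -/

theorem Matrix.linfty_opNorm_map_ofReal {n : Type*} [Fintype n] (A : Matrix n n ℝ) :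
    ‖A.map (algebraMap ℝ ℂ)‖ = ‖A‖ := by
  simp [Matrix.linfty_opNorm_def]

/-- Gelfand's formula gives the bound for large `m`, and `C` absorbs the rest. Jordan blocks on the
unit circle rule out `c = 1`. -/
theorem Matrix.exists_norm_pow_le {n : Type*} [Fintype n] [DecidableEq n] (A : Matrix n n ℂ)
    (h : ∀ z : ℂ, A.charpoly.IsRoot z → ‖z‖ ≤ 1) {c : ℝ} (hc : 1 < c) :
    ∃ C, 0 < C ∧ ∀ m : ℕ, ‖A ^ m‖ ≤ C * c ^ m := by
  have hc0 : 0 < c := one_pos.trans hc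
  have hr : spectralRadius ℂ A < ENNReal.ofReal c := by
    refine lt_of_le_of_lt (b := 1) ?_ (by simpa using hc)
    refine iSup₂_le fun z hz => ?_
    have := h z (Matrix.mem_spectrum_iff_isRoot_charpoly.1 hz)
    exact_mod_cast this
  have hev := (spectrum.pow_norm_pow_one_div_tendsto_nhds_spectralRadius A).eventually_lt_const hr
  have hev' : ∀ᶠ m : ℕ in atTop, ‖A ^ m‖ ≤ c ^ m := by
    filter_upwards [hev, eventually_gt_atTop 0] with m hm hm0
    have h1 : ‖A ^ m‖ ^ (1 / m : ℝ) < c := (ENNReal.ofReal_lt_ofReal_iff hc0).1 hm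
    have h2 := pow_le_pow_left₀ (by positivity) h1.le m
    rwa [← Real.rpow_natCast, ← Real.rpow_mul (norm_nonneg _), one_div,
      inv_mul_cancel₀ (by positivity), Real.rpow_one] at h2
  obtain ⟨N, hN⟩ := eventually_atTop.1 hev'
  refine ⟨1 + ∑ i ∈ Finset.range N, ‖A ^ i‖, by positivity, fun m => ?_⟩
  have h1 : 1 ≤ c ^ m := one_le_pow₀ hc.le
  have hs : 0 ≤ ∑ i ∈ Finset.range N, ‖A ^ i‖ := by positivity
  rcases le_or_gt N m with hm | hm
  · have := hN m hm
    nlinarith [mul_nonneg hs (zero_le_one.trans h1)]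
  · have := Finset.single_le_sum (f := fun i => ‖A ^ i‖) (fun i _ => norm_nonneg _)
      (Finset.mem_range.2 hm)
    nlinarith

theorem LinearMap.exists_norm_pow_apply_le {V : Type*} [NormedAddCommGroup V] [NormedSpace ℝ V]
    [FiniteDimensional ℝ V] (T : V →ₗ[ℝ] V)
    (h : ∀ z : ℂ, aeval z T.charpoly = 0 → ‖z‖ ≤ 1) {c : ℝ} (hc : 1 < c) :
    ∃ C, 0 < C ∧ ∀ (m : ℕ) (v : V), ‖(T ^ m) v‖ ≤ C * c ^ m * ‖v‖ := by
  let b := Module.finBasis ℝ V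
  let A := LinearMap.toMatrix b b T
  obtain ⟨C, hC, hA⟩ := Matrix.exists_norm_pow_le (A.map (algebraMap ℝ ℂ)) (fun z hz => h z (by
    rw [← LinearMap.charpoly_toMatrix T b, aeval_def, ← eval_map]
    rw [Matrix.charpoly_map] at hz
    exact hz)) hc
  let e := b.equivFunL
  have hpow (m : ℕ) (v : V) : (T ^ m) v = e.symm ((A ^ m).mulVec (e v)) := by
    rw [ContinuousLinearEquiv.eq_symm_apply]
    have : A ^ m = LinearMap.toMatrix b b (T ^ m) := (LinearMap.toMatrix_pow b T m)
    rw [this]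
    exact (LinearMap.toMatrix_mulVec_repr b b (T ^ m) v).symm
  have hA' (m : ℕ) : ‖A ^ m‖ ≤ C * c ^ m := by
    rw [← Matrix.linfty_opNorm_map_ofReal, Matrix.map_pow]
    exact hA m
  have hpos : 0 < c := one_pos.trans hc
  set K₁ := ‖(e.symm : (Fin (Module.finrank ℝ V) → ℝ) →L[ℝ] V)‖
  set K₂ := ‖(e : V →L[ℝ] (Fin (Module.finrank ℝ V) → ℝ))‖
  -- The `+ 1` keeps the constant positive on the zero space.
  refine ⟨K₁ * C * K₂ + 1, by positivity, fun m v => ?_⟩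
  calc ‖(T ^ m) v‖ = ‖e.symm ((A ^ m).mulVec (e v))‖ := by rw [hpow]
    _ ≤ K₁ * ‖(A ^ m).mulVec (e v)‖ :=
      (e.symm : (Fin (Module.finrank ℝ V) → ℝ) →L[ℝ] V).le_opNorm _
    _ ≤ K₁ * ((C * c ^ m) * (K₂ * ‖v‖)) := by
      gcongr
      refine (Matrix.linfty_opNorm_mulVec _ _).trans ?_
      gcongr
      · exact hA' m
      · exact (e : V →L[ℝ] (Fin (Module.finrank ℝ V) → ℝ)).le_opNorm v
    _ = (K₁ * C * K₂) * c ^ m * ‖v‖ := by ring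
    _ ≤ (K₁ * C * K₂ + 1) * c ^ m * ‖v‖ := by gcongr; linarith

theorem Module.End.baseChange_aeval {V : Type*} [AddCommGroup V] [Module ℝ V]
    (T : Module.End ℝ V) (p : ℝ[X]) :
    aeval (T.baseChange ℂ) p = (aeval T p).baseChange ℂ :=
  aeval_algHom_apply (Module.End.baseChangeHom ℝ ℂ V) T p

theorem Module.End.aeval_charpoly_eq_zero_iff {V : Type*} [AddCommGroup V] [Module ℝ V]
    [FiniteDimensional ℝ V] (T : Module.End ℝ V) (z : ℂ) :
    aeval z (LinearMap.charpoly T) = 0 ↔ z ∈ spectrum ℂ (T.baseChange ℂ : Module.End ℂ _) := by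
  rw [Module.End.mem_spectrum_iff_isRoot_charpoly, LinearMap.charpoly_baseChange, IsRoot.def,
    eval_map_algebraMap]

/-- Eigenvalues are roots of the complex minimal polynomial, which divides every annihilating
polynomial. -/
theorem Module.End.aeval_eq_zero_of_aeval_charpoly {V : Type*} [AddCommGroup V] [Module ℝ V]
    [FiniteDimensional ℝ V] (T : Module.End ℝ V) {p : ℝ[X]} (hp : aeval T p = 0) {z : ℂ}
    (hz : aeval z (LinearMap.charpoly T) = 0) : aeval z p = 0 := by
  rw [Module.End.aeval_charpoly_eq_zero_iff, ← Module.End.hasEigenvalue_iff_mem_spectrum,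
    Module.End.hasEigenvalue_iff_isRoot] at hz
  have h : minpoly ℂ (T.baseChange ℂ : Module.End ℂ _) ∣ p.map (algebraMap ℝ ℂ) := by
    refine minpoly.dvd _ _ ?_
    rw [aeval_map_algebraMap, Module.End.baseChange_aeval, hp, LinearMap.baseChange_zero]
  simpa [eval_map_algebraMap] using hz.dvd h

theorem Module.End.aeval_charpoly_symm {V : Type*} [AddCommGroup V] [Module ℝ V]
    [FiniteDimensional ℝ V] (e : V ≃ₗ[ℝ] V) {z : ℂ}
    (hz : aeval z (LinearMap.charpoly (e.symm : V →ₗ[ℝ] V)) = 0) :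
    aeval z⁻¹ (LinearMap.charpoly (e : V →ₗ[ℝ] V)) = 0 := by
  rw [Module.End.aeval_charpoly_eq_zero_iff] at hz ⊢
  let u : (Module.End ℂ (TensorProduct ℝ ℂ V))ˣ :=
    ⟨(e : V →ₗ[ℝ] V).baseChange ℂ, (e.symm : V →ₗ[ℝ] V).baseChange ℂ,
      by rw [Module.End.mul_eq_comp, ← LinearMap.baseChange_comp]; simp; rfl,
      by rw [Module.End.mul_eq_comp, ← LinearMap.baseChange_comp]; simp; rfl⟩
  have : z ∈ spectrum ℂ (↑u⁻¹ : Module.End ℂ (TensorProduct ℝ ℂ V)) := hz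
  rw [← spectrum.map_inv] at this
  exact this

/-- The roots are Galois conjugate over `ℝ`, hence equal or complex conjugate. -/
theorem Complex.norm_eq_of_aeval_irreducible {p : ℝ[X]} (hp : Irreducible p) {z w : ℂ}
    (hz : aeval z p = 0) (hw : aeval w p = 0) : ‖z‖ = ‖w‖ := by
  have h : IsConjRoot ℝ z w := by
    rw [isConjRoot_def, ← minpoly.eq_of_irreducible hp hz, ← minpoly.eq_of_irreducible hp hw]
  have : IsAlgClosure ℝ ℂ := ⟨inferInstance, inferInstance⟩
  have : Normal ℝ ℂ := IsAlgClosure.normal ℝ ℂ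
  obtain ⟨σ, rfl⟩ := h.exists_algEquiv
  rcases Complex.real_algHom_eq_id_or_conj (σ : ℂ →ₐ[ℝ] ℂ) with h | h
  · have := congrArg (fun φ : ℂ →ₐ[ℝ] ℂ => φ w) h
    simp at this; rw [this]
  · have := congrArg (fun φ : ℂ →ₐ[ℝ] ℂ => φ w) h
    simp at this; rw [this]; simp

/-- All roots of an irreducible factor share one modulus, so each factor goes wholly to one side and
the splitting stays real. -/
theorem Polynomial.exists_mul_eq_of_norm_roots {p : ℝ[X]} (hp : p ≠ 0) :
    ∃ a b : ℝ[X], p = a * b ∧ (∀ z : ℂ, aeval z a = 0 → 1 < ‖z‖) ∧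
      ∀ z : ℂ, aeval z b = 0 → ‖z‖ ≤ 1 := by
  induction p using WfDvdMonoid.induction_on_irreducible with
  | zero => exact absurd rfl hp
  | unit u hu =>
    refine ⟨u, 1, by simp, fun z hz => ?_, by simp⟩
    obtain ⟨c, hc, rfl⟩ := Polynomial.isUnit_iff.1 hu
    simp at hz
    exact absurd hz hc.ne_zero
  | mul p i hp0 hi ih =>
    obtain ⟨a, b, rfl, ha, hb⟩ := ih hp0
    by_cases h : ∃ z : ℂ, aeval z i = 0 ∧ 1 < ‖z‖
    · obtain ⟨w, hw, hw1⟩ := h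
      refine ⟨i * a, b, by ring, fun z hz => ?_, hb⟩
      rw [map_mul, mul_eq_zero] at hz
      rcases hz with hz | hz
      · rwa [Complex.norm_eq_of_aeval_irreducible hi hz hw]
      · exact ha z hz
    · push Not at h
      refine ⟨a, i * b, by ring, ha, fun z hz => ?_⟩
      rw [map_mul, mul_eq_zero] at hz
      exact hz.elim (h z) (hb z)

theorem Polynomial.isCoprime_of_aeval_ne_zero {a b : ℝ[X]}
    (h : ∀ z : ℂ, aeval z a = 0 → aeval z b ≠ 0) : IsCoprime a b := by
  rw [← isCoprime_map (algebraMap ℝ ℂ)]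
  refine isCoprime_of_irreducible_dvd ?_ ?_
  · rintro ⟨ha, hb⟩
    rw [Polynomial.map_eq_zero] at ha hb
    exact h 0 (by simp [ha]) (by simp [hb])
  · intro z hz hza hzb
    obtain ⟨w, hw⟩ := IsAlgClosed.exists_root z (degree_pos_of_irreducible hz).ne'
    refine h w ?_ ?_
    · simpa [eval_map_algebraMap] using hw.dvd hza
    · simpa [eval_map_algebraMap] using hw.dvd hzb

end LinearAlgebra

/-! ### Expanding and non-expanding invariant subspaces -/

section Splitting

open Polynomial

theorem LinearMap.norm_det_eq_norm_prod_roots {V : Type*} [AddCommGroup V] [Module ℝ V]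
    [FiniteDimensional ℝ V] (T : V →ₗ[ℝ] V) :
    |LinearMap.det T| = ‖(T.charpoly.map (algebraMap ℝ ℂ)).roots.prod‖ := by
  rw [← LinearMap.charpoly_baseChange,
    ← Module.End.det_eq_prod_roots_charpoly_of_splits (IsAlgClosed.splits _),
    LinearMap.det_baseChange]
  simp

theorem LinearMap.det_ne_zero_of_one_lt_norm {V : Type*} [AddCommGroup V] [Module ℝ V]
    [FiniteDimensional ℝ V] (T : V →ₗ[ℝ] V)
    (h : ∀ z : ℂ, aeval z T.charpoly = 0 → 1 < ‖z‖) : LinearMap.det T ≠ 0 := by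
  rw [← abs_ne_zero, LinearMap.norm_det_eq_norm_prod_roots, norm_ne_zero_iff]
  refine Multiset.prod_ne_zero fun h0 => ?_
  have := h 0 (by simpa [eval_map_algebraMap] using (mem_roots'.1 h0).2)
  simp at this
  linarith

theorem LinearMap.aeval_charpoly_id_eq_zero {V : Type*} [AddCommGroup V] [Module ℝ V]
    [FiniteDimensional ℝ V] {z : ℂ}
    (hz : aeval z (LinearMap.charpoly (LinearMap.id : V →ₗ[ℝ] V)) = 0) : z = 1 := by
  have := Module.End.aeval_eq_zero_of_aeval_charpoly (LinearMap.id : V →ₗ[ℝ] V)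
    (p := X - 1) (by simp [Module.End.one_eq_id]) hz
  simpa [sub_eq_zero] using this

theorem LinearMap.coe_aeval_restrict_apply {V : Type*} [AddCommGroup V] [Module ℝ V]
    (f : V →ₗ[ℝ] V) {U : Submodule ℝ V} (hU : ∀ x ∈ U, f x ∈ U) (p : ℝ[X]) (x : U) :
    (aeval (f.restrict hU) p x : V) = aeval f p x := by
  induction p using Polynomial.induction_on' with
  | add p q hp hq => simp [hp, hq]
  | monomial n a => rw [aeval_monomial, aeval_monomial, Module.End.pow_restrict n]; rfl

/-- Factor the characteristic polynomial as `a * b` by modulus of roots; the kernels of `a(f)` and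
`b(f)` are complementary by coprimality and Cayley–Hamilton. -/
theorem LinearMap.exists_invariant_isCompl {V : Type*} [AddCommGroup V] [Module ℝ V]
    [FiniteDimensional ℝ V] (f : V →ₗ[ℝ] V) :
    ∃ (U W : Submodule ℝ V) (hU : ∀ x ∈ U, f x ∈ U) (hW : ∀ x ∈ W, f x ∈ W), IsCompl U W ∧
      (∀ z : ℂ, aeval z (f.restrict hU).charpoly = 0 → 1 < ‖z‖) ∧
      ∀ z : ℂ, aeval z (f.restrict hW).charpoly = 0 → ‖z‖ ≤ 1 := by
  obtain ⟨a, b, hab, ha, hb⟩ := exists_mul_eq_of_norm_roots f.charpoly_monic.ne_zero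
  have hcop : IsCoprime a b :=
    isCoprime_of_aeval_ne_zero fun z hza hzb => (ha z hza).not_ge (hb z hzb)
  have hinv (p : ℝ[X]) : ∀ x ∈ LinearMap.ker (aeval f p), f x ∈ LinearMap.ker (aeval f p) := by
    intro x hx
    rw [LinearMap.mem_ker] at hx ⊢
    have : (aeval f p * f) x = (f * aeval f p) x := by
      nth_rw 2 3 [← aeval_X (R := ℝ) f]
      rw [← map_mul, ← map_mul, mul_comm]
    rw [Module.End.mul_apply, Module.End.mul_apply, hx, map_zero] at this
    exact this
  have hzero (p : ℝ[X]) : aeval (f.restrict (hinv p)) p = 0 := by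
    ext x
    rw [LinearMap.coe_aeval_restrict_apply]
    exact x.2
  refine ⟨LinearMap.ker (aeval f a), LinearMap.ker (aeval f b), hinv a, hinv b,
    ⟨disjoint_ker_aeval_of_isCoprime f hcop, ?_⟩, fun z hz => ha z ?_, fun z hz => hb z ?_⟩
  · rw [codisjoint_iff, sup_ker_aeval_eq_ker_aeval_mul_of_coprime f hcop, ← hab,
      LinearMap.aeval_self_charpoly, LinearMap.ker_zero]
  · exact Module.End.aeval_eq_zero_of_aeval_charpoly _ (hzero a) hz
  · exact Module.End.aeval_eq_zero_of_aeval_charpoly _ (hzero b) hz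

/-- With `g` equal to `f` on `U` and to the identity on `W`, `g⁻¹` contributes inverses of expanding
eigenvalues and `1`, while `g⁻¹ f` is the identity on `U` and `f` on `W`. -/
theorem LinearMap.exists_expanding_part {V : Type*} [AddCommGroup V] [Module ℝ V]
    [FiniteDimensional ℝ V] (f : V →ₗ[ℝ] V) {Λ : ℝ}
    (hΛ : Λ = ‖((f.charpoly.map (algebraMap ℝ ℂ)).roots.filter fun z : ℂ => 1 < ‖z‖).prod‖) :
    ∃ (U : Submodule ℝ V) (hU : ∀ x ∈ U, f x ∈ U) (g : V ≃ₗ[ℝ] V),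
      |LinearMap.det (f.restrict hU)| = Λ ∧ |LinearMap.det (g : V →ₗ[ℝ] V)| = Λ ∧ Λ ≠ 0 ∧
      (∀ x, g (f x) = f (g x)) ∧
      (∀ z : ℂ, aeval z (LinearMap.charpoly (g.symm : V →ₗ[ℝ] V)) = 0 → ‖z‖ ≤ 1) ∧
      ∀ z : ℂ, aeval z (LinearMap.charpoly ((g.symm : V →ₗ[ℝ] V) ∘ₗ f)) = 0 → ‖z‖ ≤ 1 := by
  obtain ⟨U, W, hU, hW, hUW, hUr, hWr⟩ := f.exists_invariant_isCompl
  set fU := f.restrict hU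
  set fW := f.restrict hW
  let e := U.prodEquivOfIsCompl W hUW
  have hdet : LinearMap.det fU ≠ 0 := LinearMap.det_ne_zero_of_one_lt_norm fU hUr
  let a : U ≃ₗ[ℝ] U := LinearMap.equivOfDetNeZero fU hdet
  have ha : (a : U →ₗ[ℝ] U) = fU := by ext; rfl
  let g₀ : (U × W) ≃ₗ[ℝ] (U × W) := a.prodCongr (LinearEquiv.refl ℝ W)
  have hg₀ : (g₀ : (U × W) →ₗ[ℝ] (U × W)) = fU.prodMap LinearMap.id := by
    ext <;> rfl
  have hg₀s : (g₀.symm : (U × W) →ₗ[ℝ] (U × W)) =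
    (a.symm : U →ₗ[ℝ] U).prodMap LinearMap.id := by
    ext <;> rfl
  have hf : f = e.conj (fU.prodMap fW) := by
    ext x
    obtain ⟨y, rfl⟩ := e.surjective x
    simp [e, LinearEquiv.conj_apply, fU, fW]
  let g : V ≃ₗ[ℝ] V := (e.symm.trans g₀).trans e
  have hg : (g : V →ₗ[ℝ] V) = e.conj (g₀ : (U × W) →ₗ[ℝ] (U × W)) := by
    ext; rfl
  have hgs : (g.symm : V →ₗ[ℝ] V) = e.conj (g₀.symm : (U × W) →ₗ[ℝ] (U × W)) := by
    ext; rfl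
  have hgf : (g.symm : V →ₗ[ℝ] V) ∘ₗ f = e.conj (LinearMap.id.prodMap fW) := by
    rw [hgs, hf, ← LinearEquiv.conj_comp, hg₀s, LinearMap.prodMap_comp, ← ha]
    simp
  have hΛU : |LinearMap.det fU| = Λ := by
    have hp : f.charpoly = fU.charpoly * fW.charpoly := by
      conv_lhs => rw [hf, LinearEquiv.charpoly_conj, LinearMap.charpoly_prodMap]
    have hne : (fU.charpoly * fW.charpoly).map (algebraMap ℝ ℂ) ≠ 0 :=
      ((fU.charpoly_monic.mul fW.charpoly_monic).map _).ne_zero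
    rw [hΛ, hp, LinearMap.norm_det_eq_norm_prod_roots, Polynomial.map_mul,
      roots_mul (by rwa [← Polynomial.map_mul]), Multiset.filter_add,
      Multiset.filter_eq_self.2, Multiset.filter_eq_nil.2, add_zero]
    · intro z hz
      exact (hWr z (by simpa [eval_map_algebraMap] using (mem_roots'.1 hz).2)).not_gt
    · intro z hz
      exact hUr z (by simpa [eval_map_algebraMap] using (mem_roots'.1 hz).2)
  refine ⟨U, hU, g, hΛU, ?_, ?_, ?_, ?_, ?_⟩
  · rw [hg, LinearEquiv.conj_apply, LinearMap.comp_assoc, LinearMap.det_conj, hg₀,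
      LinearMap.det_prodMap, LinearMap.det_id, mul_one, hΛU]
  · rw [← hΛU]; exact abs_ne_zero.2 hdet
  · intro x
    have : (g : V →ₗ[ℝ] V) ∘ₗ f = f ∘ₗ g := by
      rw [hg, hf, ← LinearEquiv.conj_comp, ← LinearEquiv.conj_comp, hg₀,
        LinearMap.prodMap_comp, LinearMap.prodMap_comp]
      simp
    exact LinearMap.congr_fun this x
  · intro z hz
    rw [hgs, LinearEquiv.charpoly_conj, hg₀s, LinearMap.charpoly_prodMap, map_mul,
      mul_eq_zero] at hz
    rcases hz with hz | hz
    · have := hUr _ (ha ▸ Module.End.aeval_charpoly_symm a hz)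
      rw [norm_inv] at this
      exact ((one_lt_inv_iff₀).1 this).2.le
    · rw [LinearMap.aeval_charpoly_id_eq_zero hz, norm_one]
  · intro z hz
    rw [hgf, LinearEquiv.charpoly_conj, LinearMap.charpoly_prodMap, map_mul, mul_eq_zero] at hz
    rcases hz with hz | hz
    · rw [LinearMap.aeval_charpoly_id_eq_zero hz, norm_one]
    · exact hWr z hz

end Splitting

/-! ### Covering numbers from volume -/

section Covering

open MeasureTheory Module

variable {V : Type*} [NormedAddCommGroup V] [NormedSpace ℝ V] [FiniteDimensional ℝ V]

theorem card_le_of_pairwise_dist_of_subset_image {A : Set V} (G : V →ₗ[ℝ] V) {ρ : ℝ} (hρ : 0 ≤ ρ)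
    (hA : ∀ a ∈ A, Metric.ball a (1 / 4) ⊆ G '' Metric.closedBall 0 ρ) (t : Finset V)
    (htA : ∀ a ∈ t, a ∈ A) (ht : ∀ a ∈ t, ∀ b ∈ t, a ≠ b → 1 / 2 ≤ dist a b) :
    (t.card : ℝ) ≤ |LinearMap.det G| * (4 * ρ) ^ finrank ℝ V := by
  let _ : MeasurableSpace V := borel V
  have _ : BorelSpace V := ⟨rfl⟩
  let μ : Measure V := Measure.addHaar
  set d := finrank ℝ V
  have hdisj : (t : Set V).PairwiseDisjoint fun a => Metric.ball a (1 / 4 : ℝ) := by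
    intro a ha b hb hab
    refine Metric.ball_disjoint_ball ?_
    have := ht a ha b hb hab
    linarith
  have h1 : μ (⋃ a ∈ t, Metric.ball a (1 / 4 : ℝ)) ≤ μ (G '' Metric.closedBall 0 ρ) :=
    measure_mono (Set.iUnion₂_subset fun a ha => hA a (htA a ha))
  rw [measure_biUnion_finset hdisj fun _ _ => measurableSet_ball,
    Finset.sum_congr rfl fun a _ => Measure.addHaar_ball_of_pos μ a (by norm_num : (0 : ℝ) < 1 / 4),
    Finset.sum_const, nsmul_eq_mul, Measure.addHaar_image_linearMap,
    Measure.addHaar_closedBall μ 0 hρ, ← mul_assoc, ← mul_assoc,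
    ENNReal.mul_le_mul_iff_left (Metric.measure_ball_pos μ 0 one_pos).ne' measure_ball_lt_top.ne,
    ← ENNReal.ofReal_natCast, ← ENNReal.ofReal_mul (by positivity),
    ← ENNReal.ofReal_mul (by positivity), ENNReal.ofReal_le_ofReal_iff (by positivity)] at h1
  have h4 : (0 : ℝ) < 4 ^ d := by positivity
  calc (t.card : ℝ) = (t.card * (1 / 4) ^ d) * 4 ^ d := by
        rw [mul_assoc, ← mul_pow]; norm_num
    _ ≤ (|LinearMap.det G| * ρ ^ d) * 4 ^ d := by gcongr
    _ = |LinearMap.det G| * (4 * ρ) ^ d := by rw [mul_pow]; ring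

/-- A `1/2`-separated subset of maximal size is a `1/2`-net; its disjoint quarter balls bound its
size by volume. -/
theorem exists_finset_cover_of_subset_image {A : Set V} (G : V →ₗ[ℝ] V) {ρ : ℝ} (hρ : 0 ≤ ρ)
    (hA : ∀ a ∈ A, Metric.ball a (1 / 4) ⊆ G '' Metric.closedBall 0 ρ) :
    ∃ s : Finset V, (∀ a ∈ A, ∃ b ∈ s, dist a b ≤ 1 / 2) ∧
      (s.card : ℝ) ≤ |LinearMap.det G| * (4 * ρ) ^ finrank ℝ V := by
  classical
  set P : Finset V → Prop := fun t => (∀ a ∈ t, a ∈ A) ∧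
    ∀ a ∈ t, ∀ b ∈ t, a ≠ b → 1 / 2 ≤ dist a b
  have hcard (t : Finset V) (ht : P t) :
      (t.card : ℝ) ≤ |LinearMap.det G| * (4 * ρ) ^ finrank ℝ V :=
    card_le_of_pairwise_dist_of_subset_image G hρ hA t ht.1 ht.2
  set S : Set ℕ := {n | ∃ t, P t ∧ t.card = n}
  have hbdd : BddAbove S := by
    refine ⟨⌊|LinearMap.det G| * (4 * ρ) ^ finrank ℝ V⌋₊, ?_⟩
    rintro n ⟨t, ht, rfl⟩
    exact Nat.le_floor (hcard t ht)
  obtain ⟨s, hs, hsc⟩ : sSup S ∈ S := Nat.sSup_mem ⟨0, ∅, by simp [P], rfl⟩ hbdd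
  refine ⟨s, fun a ha => ?_, hcard s hs⟩
  by_contra! hcon
  have has : a ∉ s := fun h => by have := hcon a h; simp at this; linarith
  have hins : P (insert a s) := by
    refine ⟨fun b hb => ?_, fun b hb c hc hbc => ?_⟩
    · rcases Finset.mem_insert.1 hb with rfl | hb
      exacts [ha, hs.1 b hb]
    · rcases Finset.mem_insert.1 hb with hb | hb <;> rcases Finset.mem_insert.1 hc with hc | hc
      · exact absurd (hb.trans hc.symm) hbc
      · rw [hb]; exact (hcon c hc).le
      · rw [hc, dist_comm]; exact (hcon b hb).le
      · exact hs.2 b hb c hc hbc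
  have := le_csSup hbdd ⟨insert a s, hins, rfl⟩
  rw [Finset.card_insert_of_notMem has] at this
  omega

theorem LinearMap.exists_finset_cover_pow (f : V →ₗ[ℝ] V) (g : V ≃ₗ[ℝ] V)
    (hfg : ∀ x, g (f x) = f (g x)) {c C₁ C₂ : ℝ} (hc : 0 ≤ c) (hC₁ : 0 < C₁) (hC₂ : 0 < C₂)
    (h₁ : ∀ (m : ℕ) v, ‖((g.symm : V →ₗ[ℝ] V) ^ m) v‖ ≤ C₁ * c ^ m * ‖v‖)
    (h₂ : ∀ (m : ℕ) v, ‖(((g.symm : V →ₗ[ℝ] V) ∘ₗ f) ^ m) v‖ ≤ C₂ * c ^ m * ‖v‖) (m : ℕ) :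
    ∃ s : Finset V, (∀ x, ‖x‖ ≤ 1 → ∃ y ∈ s, ‖(f ^ m) x - y‖ ≤ 1 / 2) ∧
      (s.card : ℝ) ≤ |LinearMap.det (g : V →ₗ[ℝ] V)| ^ m *
        (4 * ((C₁ + C₂) * c ^ m)) ^ finrank ℝ V := by
  set G : Module.End ℝ V := (g : V →ₗ[ℝ] V)
  set S : Module.End ℝ V := (g.symm : V →ₗ[ℝ] V)
  set T : Module.End ℝ V := (g.symm : V →ₗ[ℝ] V) ∘ₗ f
  have hGS : G * S = 1 := by ext x; simp [G, S]
  have hSG : S * G = 1 := by ext x; simp [G, S]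
  have hGT : G * T = f := by ext x; simp [G, T]
  have hcomm : Commute G T := by
    have hTG : T * G = f := by
      ext x
      simp [G, T, ← hfg]
    exact hGT.trans hTG.symm
  have hcommS : Commute G S := hGS.trans hSG.symm
  have hf (x : V) : (f ^ m) x = (G ^ m) ((T ^ m) x) := by
    rw [← Module.End.mul_apply, ← hcomm.mul_pow, hGT]
  have hS (x : V) : x = (G ^ m) ((S ^ m) x) := by
    rw [← Module.End.mul_apply, ← hcommS.mul_pow, hGS, one_pow, Module.End.one_apply]
  obtain ⟨s, hs, hcard⟩ := exists_finset_cover_of_subset_image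
    (A := (f ^ m) '' Metric.closedBall 0 1) (G ^ m) (ρ := (C₁ + C₂) * c ^ m) (by positivity) (by
      rintro _ ⟨x, hx, rfl⟩ v hv
      rw [mem_closedBall_zero_iff] at hx
      rw [Metric.mem_ball, dist_eq_norm] at hv
      -- Since `G` and `T` commute, `f ^ m = G ^ m * T ^ m`; the remainder is pulled back by `S =
      -- G⁻¹`.
      refine ⟨(T ^ m) x + (S ^ m) (v - (f ^ m) x), ?_, ?_⟩
      · rw [mem_closedBall_zero_iff]
        calc _ ≤ ‖(T ^ m) x‖ + ‖(S ^ m) (v - (f ^ m) x)‖ := norm_add_le _ _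
          _ ≤ C₂ * c ^ m * 1 + C₁ * c ^ m * 1 := by
            gcongr
            · exact (h₂ m x).trans (by gcongr)
            · exact (h₁ m _).trans (by gcongr; linarith)
          _ = _ := by ring
      · rw [map_add, ← hf, ← hS]; abel)
  refine ⟨s, fun x hx => ?_, ?_⟩
  · obtain ⟨y, hy, hxy⟩ := hs _ ⟨x, by simpa using hx, rfl⟩
    exact ⟨y, hy, by rwa [← dist_eq_norm]⟩
  · rwa [map_pow, abs_pow] at hcard

end Covering

/-! ### Lower bound: orbits with one initial jump -/

namespace CoarseEntropy

open MeasureTheory Module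

section LowerBound

variable {V : Type*} [NormedAddCommGroup V] [NormedSpace ℝ V]

theorem packingNumber_le_sepNum {X : Type*} [MetricSpace X] (f : X → X) (n : ℕ) (R : NNReal)
    (δ : ℝ) (x₀ : X) {S : Set (Fin (n + 1) → X)} (hS : S ⊆ pseudoOrbits f n δ x₀) :
    Metric.packingNumber R S ≤ sepNum f n R δ x₀ := by
  refine iSup_le fun E => iSup_le fun hE => iSup_le fun hs => ?_
  refine le_iSup_of_le E (le_iSup_of_le (hE.trans hS) (le_iSup_of_le ?_ le_rfl))
  intro x hx y hy hxy
  have : (R : ENNReal) < edist x y := hs hx hy hxy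
  rw [edist_nndist, ENNReal.coe_lt_coe] at this
  exact_mod_cast this.le

/-- The orbit that jumps by `v` in its first step and follows `f` from then on. -/
def jumpOrbit (f : V →ₗ[ℝ] V) (x₀ v : V) (k : ℕ) : Fin (k + 1 + 1) → V :=
  Fin.cons x₀ fun i : Fin (k + 1) => (f ^ (i : ℕ)) (f x₀ + v)

theorem jumpOrbit_mem_pseudoOrbits (f : V →ₗ[ℝ] V) (x₀ v : V) (k : ℕ) {δ : ℝ} (hv : ‖v‖ ≤ δ) :
    jumpOrbit f x₀ v k ∈ pseudoOrbits (fun x => f x) (k + 1) δ x₀ := by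
  refine ⟨rfl, fun i => ?_⟩
  refine Fin.cases ?_ (fun j => ?_) i
  · simpa [jumpOrbit] using hv
  · rw [jumpOrbit, Fin.cons_succ, Fin.castSucc_succ, Fin.cons_succ]
    simp only [Fin.val_castSucc, Fin.val_succ, pow_succ', Module.End.mul_apply, dist_self]
    exact (norm_nonneg v).trans hv

/-- Packing dominates covering, and a cover of the jump orbits by `R`-balls pulls back to a cover of
the `δ`-ball of `U` by sets whose volume is divided by `|det| ^ k`. -/
theorem le_sepNum_of_invariant [FiniteDimensional ℝ V] (f : V →ₗ[ℝ] V) (U : Submodule ℝ V) (hU : ∀ x ∈ U, f x ∈ U)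
    (hdet : LinearMap.det (f.restrict hU) ≠ 0) (x₀ : V) {R : NNReal} (hR : 0 < R) {δ : ℝ}
    (hδ : 0 < δ) (k : ℕ) :
    ENNReal.ofReal ((δ / R) ^ finrank ℝ U * |LinearMap.det (f.restrict hU)| ^ k) ≤
      (sepNum (fun x => f x) (k + 1) R δ x₀ : ENNReal) := by
  classical
  let _ : MeasurableSpace U := borel U
  have _ : BorelSpace U := ⟨rfl⟩
  let μ : Measure U := Measure.addHaar
  set d := finrank ℝ U
  set T : U →ₗ[ℝ] U := f.restrict hU
  have hT (v : U) : ((T ^ k) v : V) = (f ^ k) v := by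
    rw [Module.End.pow_restrict k]; rfl
  set S : Set (Fin (k + 1 + 1) → V) :=
    (fun v : U => jumpOrbit f x₀ v k) '' Metric.closedBall 0 δ
  have hS : S ⊆ pseudoOrbits (fun x => f x) (k + 1) δ x₀ := by
    rintro _ ⟨v, hv, rfl⟩
    exact jumpOrbit_mem_pseudoOrbits f x₀ v k (by simpa using hv)
  have hle : Metric.coveringNumber R S ≤ sepNum (fun x => f x) (k + 1) R δ x₀ :=
    (Metric.coveringNumber_le_packingNumber R S).trans (packingNumber_le_sepNum _ _ _ _ _ hS)
  refine le_trans ?_ (ENat.toENNReal_le.2 hle)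
  by_cases htop : Metric.coveringNumber R S = ⊤
  · simp [htop]
  obtain ⟨C, hCS, hCfin, hcov, hcard⟩ := Metric.exists_set_encard_eq_coveringNumber htop
  rw [← hcard, hCfin.encard_eq_coe_toFinset_card]
  have hch : ∀ c ∈ hCfin.toFinset, ∃ v : U, jumpOrbit f x₀ v k = c := by
    intro c hc
    obtain ⟨v, -, hv⟩ := hCS (hCfin.mem_toFinset.1 hc)
    exact ⟨v, hv⟩
  choose! w hw using hch
  have hsub : Metric.closedBall (0 : U) δ ⊆
      ⋃ c ∈ hCfin.toFinset, (T ^ k) ⁻¹' Metric.closedBall ((T ^ k) (w c)) R := by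
    intro v hv
    obtain ⟨c, hc, hvc⟩ := hcov ⟨v, hv, rfl⟩
    have hc' := hCfin.mem_toFinset.2 hc
    refine Set.mem_iUnion₂.2 ⟨c, hc', ?_⟩
    have h1 : dist (jumpOrbit f x₀ v k) c ≤ R := by
      have : edist (jumpOrbit f x₀ v k) c ≤ R := hvc
      rw [edist_nndist, ENNReal.coe_le_coe] at this
      exact_mod_cast this
    rw [← hw c hc'] at h1
    -- Only the last coordinate matters; there the common term coming from `f x₀` cancels.
    have h2 := (dist_le_pi_dist _ _ (Fin.succ (Fin.last k))).trans h1
    simp only [jumpOrbit, Fin.cons_succ, Fin.val_last, map_add, dist_add_left, ← hT] at h2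
    exact h2
  have hdetk : LinearMap.det (T ^ k) ≠ 0 := by rw [map_pow]; exact pow_ne_zero _ hdet
  have h1 := (measure_mono hsub).trans (measure_biUnion_finset_le (μ := μ) _ _)
  simp only [Measure.addHaar_preimage_linearMap μ hdetk,
    Measure.addHaar_closedBall μ _ (NNReal.coe_nonneg R), Finset.sum_const, nsmul_eq_mul] at h1
  rw [Measure.addHaar_closedBall μ _ hδ.le, ← mul_assoc, ← mul_assoc,
    ENNReal.mul_le_mul_iff_left (Metric.measure_ball_pos μ 0 one_pos).ne' measure_ball_lt_top.ne,
    ← ENNReal.ofReal_natCast, ← ENNReal.ofReal_mul (by positivity),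
    ← ENNReal.ofReal_mul (by positivity), ENNReal.ofReal_le_ofReal_iff (by positivity),
    map_pow, abs_inv, abs_pow] at h1
  rw [ENat.toENNReal_coe, ← ENNReal.ofReal_natCast]
  refine ENNReal.ofReal_le_ofReal ?_
  have hR' : (0 : ℝ) < R := hR
  have hpos : 0 < |LinearMap.det T| ^ k := pow_pos (abs_pos.2 hdet) k
  rw [div_pow, div_mul_eq_mul_div, div_le_iff₀ (by positivity)]
  calc δ ^ d * |LinearMap.det T| ^ k
      ≤ (hCfin.toFinset.card * (|LinearMap.det T| ^ k)⁻¹ * (R : ℝ) ^ d) * |LinearMap.det T| ^ k := by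
        gcongr
    _ = _ := by field_simp

theorem le_sepGrowth_of_invariant [FiniteDimensional ℝ V] (f : V →ₗ[ℝ] V) (U : Submodule ℝ V) (hU : ∀ x ∈ U, f x ∈ U)
    (hdet : LinearMap.det (f.restrict hU) ≠ 0) (x₀ : V) {δ : ℝ} (hδ : 0 < δ) (R : ℝ) :
    ((Real.log |LinearMap.det (f.restrict hU)| : ℝ) : EReal) ≤
      sepGrowth (fun x => f x) R δ x₀ := by
  set D := |LinearMap.det (f.restrict hU)|
  have hD : 0 < D := abs_pos.2 hdet
  set R' : NNReal := max 1 R.toNNReal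
  have hR' : 0 < R' := lt_of_lt_of_le one_pos (le_max_left _ _)
  have hRR' : R ≤ R' := (Real.le_coe_toNNReal R).trans (by exact_mod_cast le_max_right _ _)
  refine le_trans ?_ (sepGrowth_le (fun x => f x) x₀ hRR' le_rfl)
  set κ := (δ / R') ^ finrank ℝ U
  have hκ : 0 < κ := by have : (0 : ℝ) < R' := hR'; positivity
  -- For `n = k + 1` this is `log (κ * D ^ k) / n`; the jump uses up one step.
  have hlim : Tendsto (fun n : ℕ => (Real.log κ - Real.log D) / n + Real.log D) atTop
      (𝓝 (Real.log D)) := by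
    simpa using (tendsto_const_div_atTop_nhds_zero_nat (Real.log κ - Real.log D)).add_const
      (Real.log D)
  have hlim' := (continuous_coe_real_ereal.tendsto _).comp hlim
  rw [← hlim'.limsup_eq]
  refine limsup_le_limsup ?_
  filter_upwards [eventually_gt_atTop 0] with n hn
  obtain ⟨k, rfl⟩ := Nat.exists_eq_succ_of_ne_zero hn.ne'
  have h1 := ENNReal.log_monotone (le_sepNum_of_invariant f U hU hdet x₀ hR' hδ k)
  rw [ENNReal.log_ofReal_of_pos (by positivity), Real.log_mul hκ.ne' (pow_pos hD k).ne',
    Real.log_pow D k] at h1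
  refine le_trans ?_ (EReal.div_le_div_right_of_nonneg (Nat.cast_nonneg' _) h1)
  have : (((k.succ : ℕ) : EReal)) = (((k.succ : ℕ) : ℝ) : EReal) := rfl
  rw [this, ← EReal.coe_div]
  refine EReal.coe_le_coe_iff.2 (le_of_eq ?_)
  have : (k : ℝ) + 1 ≠ 0 := by positivity
  push_cast
  field_simp
  ring

end LowerBound

end CoarseEntropy

/-! ### Upper bound: coding pseudoorbits in blocks -/

namespace CoarseEntropy

section UpperBound

variable {V : Type*} [NormedAddCommGroup V] [NormedSpace ℝ V]

theorem norm_pow_apply_le_of_norm_le (f : V →ₗ[ℝ] V) {L : ℝ} (hL : 1 ≤ L)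
    (hf : ∀ v, ‖f v‖ ≤ L * ‖v‖) {j m : ℕ} (hj : j ≤ m) (v : V) : ‖(f ^ j) v‖ ≤ L ^ m * ‖v‖ := by
  have h : ‖(f ^ j) v‖ ≤ L ^ j * ‖v‖ := by
    induction j with
    | zero => simp
    | succ j ih =>
      rw [pow_succ', Module.End.mul_apply, pow_succ', mul_assoc]
      exact (hf _).trans (by gcongr; exact ih (by omega))
  exact h.trans (by gcongr)

/-- A crude drift bound suffices, because `r` and `R` are chosen after `m` and `δ`. -/
theorem norm_sub_pow_apply_le (f : V →ₗ[ℝ] V) {L : ℝ} (hL : 1 ≤ L)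
    (hf : ∀ v, ‖f v‖ ≤ L * ‖v‖) {δ : ℝ} (hδ : 0 ≤ δ) {n : ℕ} {x : ℕ → V}
    (hx : ∀ i < n, dist (f (x i)) (x (i + 1)) ≤ δ) (i : ℕ) {j m : ℕ} (hij : i + j ≤ n)
    (hj : j ≤ m) : ‖x (i + j) - (f ^ j) (x i)‖ ≤ m * δ * L ^ m := by
  have h : ‖x (i + j) - (f ^ j) (x i)‖ ≤ j * δ * L ^ j := by
    induction j with
    | zero => simp
    | succ j ih =>
      have h1 := hx (i + j) (by omega)
      rw [dist_comm, dist_eq_norm] at h1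
      calc ‖x (i + (j + 1)) - (f ^ (j + 1)) (x i)‖
          = ‖(x (i + j + 1) - f (x (i + j))) + f (x (i + j) - (f ^ j) (x i))‖ := by
            rw [pow_succ', Module.End.mul_apply, map_sub, add_assoc]; congr 1; abel
        _ ≤ δ + L * (j * δ * L ^ j) := by
            refine (norm_add_le _ _).trans (add_le_add h1 ((hf _).trans ?_))
            gcongr
            exact ih (by omega) (by omega)
        _ ≤ δ * L ^ (j + 1) + L * (j * δ * L ^ j) := by
            gcongr
            exact le_mul_of_one_le_right hδ (one_le_pow₀ hL)
        _ = ((j + 1 : ℕ) : ℝ) * δ * L ^ (j + 1) := by push_cast; ring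
  exact h.trans (by gcongr)

/-- The centers of the balls of radius `r` in which a sequence is found at the multiples of `m`,
where `sel` selects, for a point `v` of the unit ball, a point close to its image under `f ^ m`. -/
noncomputable def blockCenter (f : V →ₗ[ℝ] V) (sel : V → V) (r : ℝ) (m : ℕ) (x : ℕ → V) : ℕ → V
  | 0 => x 0
  | k + 1 => (f ^ m) (blockCenter f sel r m x k) +
      r • sel (r⁻¹ • (x (k * m) - blockCenter f sel r m x k))

/-- The selected points that determine the centers. -/
noncomputable def blockCode (f : V →ₗ[ℝ] V) (sel : V → V) (r : ℝ) (m : ℕ) (x : ℕ → V) (k : ℕ) : V :=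
  sel (r⁻¹ • (x (k * m) - blockCenter f sel r m x k))

theorem blockCenter_congr (f : V →ₗ[ℝ] V) (sel : V → V) (r : ℝ) (m : ℕ) {x y : ℕ → V}
    (h0 : x 0 = y 0) {K : ℕ} (h : ∀ k < K, blockCode f sel r m x k = blockCode f sel r m y k)
    {k : ℕ} (hk : k ≤ K) : blockCenter f sel r m x k = blockCenter f sel r m y k := by
  induction k with
  | zero => exact h0
  | succ k ih =>
    have h1 := h k hk
    rw [blockCode, blockCode] at h1
    rw [blockCenter, blockCenter, h1, ih (by omega)]

/-- Over one block the rescaled cover loses at most `r / 2` and the drift at most `r / 2`, so the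
radius `r` reproduces itself. -/
theorem norm_sub_blockCenter_le (f : V →ₗ[ℝ] V) {sel : V → V} {m : ℕ}
    (hsel : ∀ v, ‖v‖ ≤ 1 → ‖(f ^ m) v - sel v‖ ≤ 1 / 2) {L : ℝ} (hL : 1 ≤ L)
    (hf : ∀ v, ‖f v‖ ≤ L * ‖v‖) {δ : ℝ} (hδ : 0 ≤ δ) {n : ℕ} {x : ℕ → V}
    (hx : ∀ i < n, dist (f (x i)) (x (i + 1)) ≤ δ) {r : ℝ} (hr : 0 < r)
    (hrδ : m * δ * L ^ m ≤ r / 2) {k : ℕ} (hk : k * m ≤ n) :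
    ‖x (k * m) - blockCenter f sel r m x k‖ ≤ r := by
  induction k with
  | zero => simpa [blockCenter] using hr.le
  | succ k ih =>
    have hk' : k * m + m ≤ n := by rwa [← Nat.succ_mul]
    have ih' := ih (by omega)
    set p := blockCenter f sel r m x k
    set u := r⁻¹ • (x (k * m) - p) with hu
    have hu1 : ‖u‖ ≤ 1 := by
      rw [hu, norm_smul, norm_inv, Real.norm_of_nonneg hr.le, inv_mul_le_iff₀ hr]
      linarith
    have hru : x (k * m) - p = r • u := by rw [hu, smul_inv_smul₀ hr.ne']
    have h1 := norm_sub_pow_apply_le f hL hf hδ hx (k * m) hk' le_rfl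
    have h2 := hsel u hu1
    rw [blockCenter, Nat.succ_mul]
    calc ‖x (k * m + m) - ((f ^ m) p + r • sel u)‖
        = ‖(x (k * m + m) - (f ^ m) (x (k * m))) + r • ((f ^ m) u - sel u)‖ := by
          rw [smul_sub, ← map_smul, ← hru, map_sub]; congr 1; abel
      _ ≤ r / 2 + r * (1 / 2) := by
          refine (norm_add_le _ _).trans (add_le_add (h1.trans hrδ) ?_)
          rw [norm_smul, Real.norm_of_nonneg hr.le]
          gcongr
      _ = r := by ring

/-- Equal codes give equal centers, so at block starts two such pseudoorbits are `2 * r` apart at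
most. Within a block this grows by at most `L ^ m`, and the two drifts add `r`: less than `R` in
total. -/
theorem sepNum_le_pow (f : V →ₗ[ℝ] V) {m : ℕ} (hm : 0 < m) {s : Finset V}
    (hs : ∀ x, ‖x‖ ≤ 1 → ∃ y ∈ s, ‖(f ^ m) x - y‖ ≤ 1 / 2) {L : ℝ} (hL : 1 ≤ L)
    (hf : ∀ v, ‖f v‖ ≤ L * ‖v‖) {δ : ℝ} (hδ : 0 ≤ δ) (x₀ : V) {r R : ℝ} (hr : 0 < r)
    (hrδ : m * δ * L ^ m ≤ r / 2) (hR : L ^ m * (2 * r) + r < R) (n : ℕ) :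
    sepNum (fun x => f x) n R δ x₀ ≤ ((s.card ^ (n / m) : ℕ) : ℕ∞) := by
  classical
  choose! sel hsels hsel using hs
  refine iSup_le fun E => iSup_le fun hE => iSup_le fun hsep => ?_
  -- Extended by its last value, so that blocks can be indexed by `ℕ`.
  let ext (x : Fin (n + 1) → V) (i : ℕ) : V := x ⟨min i n, by omega⟩
  have hext0 (x) (hx : x ∈ E) : ext x 0 = x₀ := by
    rw [← (hE hx).1]; simp [ext]
  have hext (x) (hx : x ∈ E) : ∀ i < n, dist (f (ext x i)) (ext x (i + 1)) ≤ δ := by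
    intro i hi
    convert! (hE hx).2 ⟨i, hi⟩ using 2
    · simp [ext, hi.le]
    · simp [ext, Nat.succ_le_of_lt hi]
  have hnear (x) (hx : x ∈ E) (k : ℕ) (hk : k ≤ n / m) :=
    norm_sub_blockCenter_le f hsel hL hf hδ (hext x hx) hr hrδ (k := k)
      ((Nat.mul_le_mul_right m hk).trans (Nat.div_mul_le_self n m))
  let code (x : Fin (n + 1) → V) (k : Fin (n / m)) : V := blockCode f sel r m (ext x) k
  have hmaps : Set.MapsTo code E (Fintype.piFinset fun _ : Fin (n / m) => s) := by
    intro x hx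
    rw [Finset.mem_coe, Fintype.mem_piFinset]
    intro k
    refine hsels _ ?_
    rw [norm_smul, norm_inv, Real.norm_of_nonneg hr.le, inv_mul_le_iff₀ hr, mul_one]
    exact hnear x hx k k.2.le
  have hinj : Set.InjOn code E := by
    intro x hx y hy hxy
    by_contra hne
    refine (hsep x hx y hy hne).not_gt (lt_of_le_of_lt ?_ hR)
    rw [dist_pi_le_iff (by positivity)]
    intro i
    set k := (i : ℕ) / m
    set j := (i : ℕ) % m
    have hkj : k * m + j = i := by rw [mul_comm]; exact Nat.div_add_mod _ _
    have hin : (i : ℕ) ≤ n := by omega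
    have hk : k ≤ n / m := Nat.div_le_div_right hin
    have hjm : j ≤ m := (Nat.mod_lt _ hm).le
    have hi (z : Fin (n + 1) → V) : z i = ext z (k * m + j) := by
      simp [ext, hkj, hin]
    have hcen : blockCenter f sel r m (ext x) k = blockCenter f sel r m (ext y) k :=
      blockCenter_congr f sel r m ((hext0 x hx).trans (hext0 y hy).symm)
        (fun l hl => congrFun hxy ⟨l, hl⟩) hk
    have h1 := hnear x hx k hk
    have h2 := hnear y hy k hk
    have h3 := norm_sub_pow_apply_le f hL hf hδ (hext x hx) (k * m) (hkj.trans_le hin) hjm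
    have h4 := norm_sub_pow_apply_le f hL hf hδ (hext y hy) (k * m) (hkj.trans_le hin) hjm
    have h5 : ‖ext x (k * m) - ext y (k * m)‖ ≤ 2 * r := by
      rw [← hcen] at h2
      rw [← dist_eq_norm] at h1 h2 ⊢
      linarith [dist_triangle_right (ext x (k * m)) (ext y (k * m))
        (blockCenter f sel r m (ext x) k)]
    have h6 := (norm_pow_apply_le_of_norm_le f hL hf hjm (ext x (k * m) - ext y (k * m))).trans
      (mul_le_mul_of_nonneg_left h5 (by positivity))
    rw [hi x, hi y]
    rw [map_sub, ← dist_eq_norm] at h6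
    rw [← dist_eq_norm] at h3 h4
    linarith [dist_triangle4_right (ext x (k * m + j)) (ext y (k * m + j))
      ((f ^ j) (ext x (k * m))) ((f ^ j) (ext y (k * m)))]
  refine (Set.encard_le_encard_of_injOn hmaps hinj).trans ?_
  rw [Set.encard_coe_eq_coe_finsetCard, Fintype.card_piFinset_const]

theorem exists_sepGrowth_le [FiniteDimensional ℝ V] (f : V →ₗ[ℝ] V) {m : ℕ} (hm : 0 < m)
    {s : Finset V} (hs : ∀ x, ‖x‖ ≤ 1 → ∃ y ∈ s, ‖(f ^ m) x - y‖ ≤ 1 / 2) (δ : ℝ) (x₀ : V) :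
    ∃ R, sepGrowth (fun x => f x) R δ x₀ ≤ ((Real.log s.card / m : ℝ) : EReal) := by
  set L : ℝ := max 1 ‖f.toContinuousLinearMap‖
  have hL : 1 ≤ L := le_max_left _ _
  have hf (v : V) : ‖f v‖ ≤ L * ‖v‖ :=
    (f.toContinuousLinearMap.le_opNorm v).trans (by gcongr; exact le_max_right _ _)
  set δ' := max δ 0
  have hδ' : 0 ≤ δ' := le_max_right _ _
  set r : ℝ := 2 * (m * δ' * L ^ m) + 1
  have hr : 0 < r := by positivity
  refine ⟨L ^ m * (2 * r) + r + 1, ?_⟩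
  refine (sepGrowth_le (fun x => f x) x₀ le_rfl (le_max_left δ 0)).trans ?_
  have hs1 : 1 ≤ s.card := by
    obtain ⟨y, hy, -⟩ := hs 0 (by simp)
    exact Finset.card_pos.2 ⟨y, hy⟩
  have hs1' : (1 : ℝ) ≤ s.card := by exact_mod_cast hs1
  have hlog : 0 ≤ Real.log s.card := Real.log_nonneg hs1'
  refine limsup_le_of_le (by isBoundedDefault) ?_
  filter_upwards [eventually_gt_atTop 0] with n hn
  have h1 := sepNum_le_pow f hm hs hL hf hδ' x₀ hr (by simp only [r]; linarith) (lt_add_one _) n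
  have h2 := ENNReal.log_monotone (ENat.toENNReal_le.2 h1)
  rw [ENat.toENNReal_coe, ← ENNReal.ofReal_natCast, ENNReal.log_ofReal_of_pos (by positivity),
    Nat.cast_pow, Real.log_pow] at h2
  refine (EReal.div_le_div_right_of_nonneg (Nat.cast_nonneg' _) h2).trans ?_
  have : (n : EReal) = ((n : ℝ) : EReal) := rfl
  rw [this, ← EReal.coe_div]
  refine EReal.coe_le_coe_iff.2 ?_
  have hn' : (0 : ℝ) < n := by exact_mod_cast hn
  have hm' : (0 : ℝ) < m := by exact_mod_cast hm
  rw [div_le_div_iff₀ hn' hm']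
  have : ((n / m : ℕ) : ℝ) * m ≤ n := by exact_mod_cast Nat.div_mul_le_self n m
  nlinarith

end UpperBound

end CoarseEntropy

/-! ### Combining the two bounds -/

section Main

open CoarseEntropy Module

theorem exists_sepGrowth_le_log_add {V : Type*} [NormedAddCommGroup V] [NormedSpace ℝ V]
    [FiniteDimensional ℝ V] (f : V →ₗ[ℝ] V) (g : V ≃ₗ[ℝ] V) (hfg : ∀ x, g (f x) = f (g x))
    (h₁ : ∀ z : ℂ, Polynomial.aeval z (LinearMap.charpoly (g.symm : V →ₗ[ℝ] V)) = 0 → ‖z‖ ≤ 1)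
    (h₂ : ∀ z : ℂ, Polynomial.aeval z
      (LinearMap.charpoly ((g.symm : V →ₗ[ℝ] V) ∘ₗ f)) = 0 → ‖z‖ ≤ 1)
    (x₀ : V) (δ : ℝ) {ε : ℝ} (hε : 0 < ε) :
    ∃ R, sepGrowth (fun x => f x) R δ x₀ ≤
      ((Real.log |LinearMap.det (g : V →ₗ[ℝ] V)| + ε : ℝ) : EReal) := by
  set d := finrank ℝ V
  set D := |LinearMap.det (g : V →ₗ[ℝ] V)|
  have hD : 0 < D := abs_pos.2 (LinearEquiv.isUnit_det' g).ne_zero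
  -- Half of `ε` pays for the radius growth `exp (d * η * m)`, the other half for the constant `B`,
  -- spread over `m` steps. The `+ 1` covers `d = 0`.
  set η := ε / (2 * (d + 1))
  have hη : 0 < η := by positivity
  have hdη : d * η ≤ ε / 2 := by
    simp only [η]
    rw [← mul_div_assoc, div_le_div_iff₀ (by positivity) two_pos]
    nlinarith
  have hc : 1 < Real.exp η := Real.one_lt_exp_iff.2 hη
  obtain ⟨C₁, hC₁, hT₁⟩ := LinearMap.exists_norm_pow_apply_le _ h₁ hc
  obtain ⟨C₂, hC₂, hT₂⟩ := LinearMap.exists_norm_pow_apply_le _ h₂ hc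
  set B := d * Real.log (4 * (C₁ + C₂))
  obtain ⟨m, hmB⟩ := exists_nat_gt (max (2 * B / ε) 0)
  have hm' : (0 : ℝ) < m := (le_max_right _ _).trans_lt hmB
  have hm : 0 < m := by exact_mod_cast hm'
  have hBm : B ≤ ε / 2 * m := by
    have := (le_max_left _ _).trans_lt hmB
    rw [div_lt_iff₀ hε] at this
    linarith
  obtain ⟨s, hs, hcard⟩ :=
    f.exists_finset_cover_pow g hfg (Real.exp_pos η).le hC₁ hC₂ hT₁ hT₂ m
  obtain ⟨R, hR⟩ := exists_sepGrowth_le f hm hs δ x₀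
  refine ⟨R, hR.trans (EReal.coe_le_coe_iff.2 ?_)⟩
  have hs1 : (0 : ℝ) < s.card := by
    obtain ⟨y, hy, -⟩ := hs 0 (by simp)
    exact_mod_cast Finset.card_pos.2 ⟨y, hy⟩
  have hlog := Real.log_le_log hs1 hcard
  rw [← mul_assoc, Real.log_mul (by positivity) (by positivity), Real.log_pow, Real.log_pow,
    Real.log_mul (by positivity) (by positivity), Real.log_pow, Real.log_exp] at hlog
  rw [div_le_iff₀ hm']
  calc Real.log s.card ≤ m * Real.log D + d * (Real.log (4 * (C₁ + C₂)) + m * η) := hlog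
    _ = m * Real.log D + (B + m * (d * η)) := by simp only [B]; ring
    _ ≤ m * Real.log D + (ε / 2 * m + m * (ε / 2)) := by gcongr
    _ = (Real.log D + ε) * m := by ring

theorem theoremt5 (q : ℕ) (f : EuclideanSpace ℝ (Fin q) →ₗ[ℝ] EuclideanSpace ℝ (Fin q))
    (x₀ : EuclideanSpace ℝ (Fin q)) :
    CoarseEntropy.coarseEntropy (fun x => f x) x₀ =
      ((Real.log (CoarseEntropy.expandingProduct f) : ℝ) : EReal) := by
  obtain ⟨U, hU, g, hUΛ, hgΛ, hΛ, hfg, h₁, h₂⟩ :=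
    f.exists_expanding_part (Λ := expandingProduct f) rfl
  rw [coarseEntropy_eq]
  refine le_antisymm (iSup_le fun δ => ?_) ?_
  · refine EReal.le_of_forall_lt_iff_le.1 fun y hy => ?_
    obtain ⟨R, hR⟩ := exists_sepGrowth_le_log_add f g hfg h₁ h₂ x₀ δ
      (sub_pos.2 (EReal.coe_lt_coe_iff.1 hy))
    rw [hgΛ, add_sub_cancel] at hR
    exact (iInf_le _ R).trans hR
  -- Any positive `δ` would do: the jump size affects only the constant factor.
  · refine le_iSup_of_le 1 (le_iInf fun R => ?_)
    rw [← hUΛ] at hΛ ⊢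
    exact le_sepGrowth_of_invariant f U hU (abs_ne_zero.1 hΛ) x₀ one_pos R

end Main
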